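/- A graphon is a measurable symmetric function $\mathcal{W}:[0,1]^2\to[0,1]$; it acts on $L^2([0,1])$ as the self-adjoint kernel operator $f\mapsto\int_0^1\mathcal{W}(\cdot,y)f(y)\,dy$. Let $\lambda_j$ range over its nonzero eigenvalues, repeated according to multiplicity, and for $z\in\mathbb{C}$ put $$\det{}^{(2)}(I-z\mathcal{W})=\prod_j(1-\lambda_jz)e^{\lambda_jz},\qquad \psi_{\mathcal{W}}(z)=\det{}^{(2)}(I-z\mathcal{W})\,\exp\!\Big(z^2\cdot\frac{\|\mathcal{W}\|_2^2-\|\mathcal{W}\|_1}{2}\Big),$$ where $\|\cdot\|_1,\|\cdot\|_2$ are the $L^1$ and $L^2$ norms on $[0,1]^2$; $\psi_{\mathcal{W}}$ is the characteristic power series of $\mathcal{W}$. For graphons $\mathcal{G},\mathcal{H}$ and $p\in[0,1]$, the $p$-disjoint union $\mathcal{G}\oplus_p\mathcal{H}$ is the graphon with kernel $$W(x,y)=\begin{cases}\mathcal{G}\big(\tfrac xp,\tfrac yp\big)& x,y\in[0,p),\\ \mathcal{H}\big(\tfrac{x-p}{1-p},\tfrac{y-p}{1-p}\big)& x,y\in[p,1],\\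 0&\text{otherwise}\end{cases}$$ (for $p=1$ the value at the single point $x=y=1$ is immaterial, and is taken to be $\mathcal{H}(0,0)$). Corollary ($p$-disjoint union). For all graphons $\mathcal{G},\mathcal{H}$, all $p\in[0,1]$ and all $z\in\mathbb{C}$, the nonzero eigenvalues of $\mathcal{G}$, $\mathcal{H}$ and $\mathcal{G}\oplus_p\mathcal{H}$ have finite multiplicity, the products defining $\psi_{\mathcal{G}}(pz)$, $\psi_{\mathcal{H}}((1-p)z)$ and $\psi_{\mathcal{G}\oplus_p\mathcal{H}}(z)$ converge unconditionally, and $$\psi_{\mathcal{G}\oplus_p\mathcal{H}}(z)=\psi_{\mathcal{G}}(pz)\cdot\psi_{\mathcal{H}}((1-p)z).$$ -/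

import Mathlib

open MeasureTheory Set

noncomputable section

/-- Lebesgue measure on `[0,1]`, as a measure on `ℝ`. -/
abbrev unitMeasure : Measure ℝ := volume.restrict (Icc (0 : ℝ) 1)

/-- A graphon, given by a representative of its kernel: a measurable symmetric function
`[0,1] × [0,1] → [0,1]`. The kernel is carried by an arbitrary measurable extension to `ℝ × ℝ`
(for instance, by zero); nothing below depends on the values outside `[0,1] × [0,1]`. -/
structure Graphon where
  /-- the kernel -/
  kernel : ℝ → ℝ → ℝ
  measurable_kernel : Measurable (Function.uncurry kernel)
  symm : ∀ x ∈ Icc (0 : ℝ) 1, ∀ y ∈ Icc (0 : ℝ) 1, kernel x y = kernel y x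
  mem_Icc : ∀ x ∈ Icc (0 : ℝ) 1, ∀ y ∈ Icc (0 : ℝ) 1, kernel x y ∈ Icc (0 : ℝ) 1

namespace Graphon

/-- The function `x ↦ ∫₀¹ W(x,y) f(y) dy`. -/
def integralTransform (W : Graphon) (f : ℝ → ℂ) (x : ℝ) : ℂ :=
  ∫ y, (W.kernel x y : ℂ) * f y ∂unitMeasure

lemma integrable_kernel_mul (W : Graphon) {f : ℝ → ℂ} (hf : MemLp f 2 unitMeasure) {x : ℝ}
    (hx : x ∈ Icc (0 : ℝ) 1) :
    Integrable (fun y => (W.kernel x y : ℂ) * f y) unitMeasure := by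
  have hfi : Integrable f unitMeasure := hf.integrable (by norm_num)
  refine hfi.bdd_mul (c := 1) ?_ ?_
  · exact (Complex.measurable_ofReal.comp
      (W.measurable_kernel.comp measurable_prodMk_left)).aestronglyMeasurable
  · filter_upwards [ae_restrict_mem measurableSet_Icc] with y hy
    have h := W.mem_Icc x hx y hy
    rw [Complex.norm_real, Real.norm_of_nonneg h.1]
    exact h.2

lemma memLp_integralTransform (W : Graphon) {f : ℝ → ℂ} (hf : MemLp f 2 unitMeasure) :
    MemLp (W.integralTransform f) 2 unitMeasure := by
  have hfi : Integrable f unitMeasure := hf.integrable (by norm_num)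
  refine MemLp.of_bound ?_ (∫ y, ‖f y‖ ∂unitMeasure) ?_
  · have h : AEStronglyMeasurable
        (fun q : ℝ × ℝ => (W.kernel q.1 q.2 : ℂ) * f q.2) (unitMeasure.prod unitMeasure) :=
      (Complex.measurable_ofReal.comp W.measurable_kernel).aestronglyMeasurable.mul
        hf.1.comp_snd
    exact h.integral_prod_right'
  · filter_upwards [ae_restrict_mem measurableSet_Icc] with x hx
    refine norm_integral_le_of_norm_le hfi.norm ?_
    filter_upwards [ae_restrict_mem measurableSet_Icc] with y hy
    have h := W.mem_Icc x hx y hy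
    rw [norm_mul, Complex.norm_real, Real.norm_of_nonneg h.1]
    exact mul_le_of_le_one_left (norm_nonneg _) h.2

/-- The kernel operator `f ↦ ∫₀¹ W(·,y) f(y) dy` of a graphon on the complex Hilbert space
`L²([0,1])`. -/
def kernelOperator (W : Graphon) : Module.End ℂ (Lp ℂ 2 unitMeasure) where
  toFun f := (W.memLp_integralTransform (Lp.memLp f)).toLp _
  map_add' f g := by
    rw [← MemLp.toLp_add, MemLp.toLp_eq_toLp_iff]
    filter_upwards [ae_restrict_mem measurableSet_Icc] with x hx
    rw [Pi.add_apply, integralTransform, integralTransform, integralTransform,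
      ← integral_add (W.integrable_kernel_mul (Lp.memLp f) hx)
        (W.integrable_kernel_mul (Lp.memLp g) hx)]
    refine integral_congr_ae ?_
    filter_upwards [Lp.coeFn_add f g] with y hy
    rw [hy, Pi.add_apply, mul_add]
  map_smul' c f := by
    rw [RingHom.id_apply, ← MemLp.toLp_const_smul, MemLp.toLp_eq_toLp_iff]
    refine Filter.Eventually.of_forall fun x => ?_
    rw [Pi.smul_apply, integralTransform, integralTransform, smul_eq_mul, ← integral_const_mul]
    refine integral_congr_ae ?_
    filter_upwards [Lp.coeFn_smul c f] with y hy
    rw [hy, Pi.smul_apply, smul_eq_mul]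
    ring

/-- The eigenspace of the kernel operator of `W` for `μ`. -/
abbrev eigenspace (W : Graphon) (μ : ℂ) : Submodule ℂ (Lp ℂ 2 unitMeasure) :=
  W.kernelOperator.eigenspace μ

/-- The multiplicity of `μ` as an eigenvalue of (the self-adjoint kernel operator of) `W`;
it is `0` if `μ` is not an eigenvalue. -/
def eigenMult (W : Graphon) (μ : ℂ) : ℕ := Module.finrank ℂ (W.eigenspace μ)

/-- The contribution `((1 - μ z) exp (μ z)) ^ m` of the nonzero number `μ`, with multiplicity `m`
as an eigenvalue, to the regularized characteristic determinant of order two. -/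
def detFactor (W : Graphon) (z : ℂ) (μ : {μ : ℂ // μ ≠ 0}) : ℂ :=
  ((1 - (μ : ℂ) * z) * Complex.exp ((μ : ℂ) * z)) ^ W.eigenMult μ

/-- The regularized characteristic determinant (Hilbert–Carleman determinant)
`det⁽²⁾(I - z W) = ∏ⱼ (1 - λⱼ z) exp (λⱼ z)`, over the eigenvalues with multiplicity (zero
eigenvalues contribute factors `1` and are left out). -/
def det2 (W : Graphon) (z : ℂ) : ℂ := ∏' μ : {μ : ℂ // μ ≠ 0}, W.detFactor z μ

/-- The product defining `det⁽²⁾(I - z W)` makes sense: nonzero eigenvalues have finite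
multiplicity and the product converges (unconditionally). -/
def Det2Converges (W : Graphon) (z : ℂ) : Prop :=
  (∀ μ : ℂ, μ ≠ 0 → FiniteDimensional ℂ (W.eigenspace μ)) ∧ Multipliable (W.detFactor z)

/-- `‖W‖₁`, the `L¹` norm of the kernel on `[0,1]²`. -/
def normOne (W : Graphon) : ℝ :=
  ∫ q : ℝ × ℝ, |W.kernel q.1 q.2| ∂(unitMeasure.prod unitMeasure)

/-- `‖W‖₂²`, the squared `L²` norm of the kernel on `[0,1]²`. -/
def normTwoSq (W : Graphon) : ℝ :=
  ∫ q : ℝ × ℝ, |W.kernel q.1 q.2| ^ 2 ∂(unitMeasure.prod unitMeasure)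

/-- The characteristic power series
`ψ_W(z) = det⁽²⁾(I - z W) exp (z² (‖W‖₂² - ‖W‖₁) / 2)`. -/
def charPowerSeries (W : Graphon) (z : ℂ) : ℂ :=
  W.det2 z * Complex.exp (z ^ 2 * (((W.normTwoSq - W.normOne) / 2 : ℝ) : ℂ))

open Classical in
/-- The kernel of the `p`-disjoint union of two graphons. -/
def disjointUnionKernel (p : ℝ) (G H : Graphon) (x y : ℝ) : ℝ :=
  if x < p ∧ y < p then G.kernel (x / p) (y / p)
  else if p ≤ x ∧ p ≤ y then H.kernel ((x - p) / (1 - p)) ((y - p) / (1 - p))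
  else 0

/-- The `p`-disjoint union `G ⊕_p H`: a copy of `G` on `[0,p)`, a copy of `H` on `[p,1]`,
and no edges between the two parts. -/
def disjointUnion (p : ℝ) (hp : p ∈ Icc (0 : ℝ) 1) (G H : Graphon) : Graphon where
  kernel := disjointUnionKernel p G H
  measurable_kernel := by
    refine Measurable.ite ?_ ?_ (Measurable.ite ?_ ?_ measurable_const)
    · exact (measurableSet_lt measurable_fst measurable_const).inter
        (measurableSet_lt measurable_snd measurable_const)
    · exact G.measurable_kernel.comp
        ((measurable_fst.div_const p).prodMk (measurable_snd.div_const p))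
    · exact (measurableSet_le measurable_const measurable_fst).inter
        (measurableSet_le measurable_const measurable_snd)
    · exact H.measurable_kernel.comp
        (((measurable_fst.sub_const p).div_const (1 - p)).prodMk
          ((measurable_snd.sub_const p).div_const (1 - p)))
  symm := by
    intro x hx y hy
    have hG : ∀ t ∈ Icc (0 : ℝ) 1, t < p → t / p ∈ Icc (0 : ℝ) 1 := fun t ht h =>
      ⟨div_nonneg ht.1 hp.1, div_le_one_of_le₀ h.le hp.1⟩
    have hH : ∀ t ∈ Icc (0 : ℝ) 1, p ≤ t → (t - p) / (1 - p) ∈ Icc (0 : ℝ) 1 := fun t ht h =>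
      ⟨div_nonneg (sub_nonneg.2 h) (sub_nonneg.2 hp.2),
        div_le_one_of_le₀ (sub_le_sub_right ht.2 p) (sub_nonneg.2 hp.2)⟩
    unfold disjointUnionKernel
    by_cases h1 : x < p <;> by_cases h2 : y < p
    · simp only [h1, h2, and_self, if_true]
      exact G.symm _ (hG x hx h1) _ (hG y hy h2)
    · simp [h1, h2, not_le.2 h1]
    · simp [h1, h2, not_le.2 h2]
    · simp only [h1, h2, not_lt.1 h1, not_lt.1 h2, and_self, if_true, if_false]
      exact H.symm _ (hH x hx (not_lt.1 h1)) _ (hH y hy (not_lt.1 h2))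
  mem_Icc := by
    intro x hx y hy
    have hG : ∀ t ∈ Icc (0 : ℝ) 1, t < p → t / p ∈ Icc (0 : ℝ) 1 := fun t ht h =>
      ⟨div_nonneg ht.1 hp.1, div_le_one_of_le₀ h.le hp.1⟩
    have hH : ∀ t ∈ Icc (0 : ℝ) 1, p ≤ t → (t - p) / (1 - p) ∈ Icc (0 : ℝ) 1 := fun t ht h =>
      ⟨div_nonneg (sub_nonneg.2 h) (sub_nonneg.2 hp.2),
        div_le_one_of_le₀ (sub_le_sub_right ht.2 p) (sub_nonneg.2 hp.2)⟩
    unfold disjointUnionKernel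
    split_ifs with h1 h2
    · exact G.mem_Icc _ (hG x hx h1.1) _ (hG y hy h1.2)
    · exact H.mem_Icc _ (hH x hx h2.1) _ (hH y hy h2.2)
    · exact ⟨le_rfl, zero_le_one⟩

end Graphon

end

/-! Cut `L²([0,1])` at `p` and rescale both pieces to the unit interval. The kernel operator of the
disjoint union becomes block diagonal, with blocks `p • G` and `(1 - p) • H`
(`splitMap_kernelOperator`). For `μ ≠ 0` its eigenspace is therefore the product of those of `G` at
`μ / p` and of `H` at `μ / (1 - p)`; multiplicities add (`eigenMult_disjointUnion`), and reindexing
the products factors the determinant (`det2_disjointUnion`). The diagonal blocks have areas `p ^ 2`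
and `(1 - p) ^ 2`, so both norm terms scale by these squares, which the factor `z ^ 2` in the
exponent turns into `(p z) ^ 2` and `((1 - p) z) ^ 2`.

Convergence needs neither compactness nor the spectral theorem. Bessel's inequality for the sections
`W(x, ·)` bounds the sum of `|μ| ^ 2`, with multiplicity, by `1`, and `(1 - w) exp w = 1 + O(w ^
2)`.

For `p = 0` and `p = 1` the union agrees almost everywhere with one of the two graphons, and the
other factor is `ψ(0) = 1`. -/

namespace Graphon

/-! ### Symmetry, the Hilbert–Schmidt bound and finite multiplicity -/

lemma measurable_ofReal_kernel (W : Graphon) :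
    Measurable (fun q : ℝ × ℝ => (W.kernel q.1 q.2 : ℂ)) :=
  Complex.measurable_ofReal.comp W.measurable_kernel

lemma norm_kernel_le_one (W : Graphon) {x y : ℝ} (hx : x ∈ Icc (0 : ℝ) 1)
    (hy : y ∈ Icc (0 : ℝ) 1) : ‖(W.kernel x y : ℂ)‖ ≤ 1 := by
  have h := W.mem_Icc x hx y hy
  rw [Complex.norm_real, Real.norm_of_nonneg h.1]
  exact h.2

instance isProbabilityMeasure_unitMeasure : IsProbabilityMeasure unitMeasure :=
  ⟨by simp⟩

lemma ae_mem_unit_prod :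
    ∀ᵐ q : ℝ × ℝ ∂(unitMeasure.prod unitMeasure), q.1 ∈ Icc (0 : ℝ) 1 ∧ q.2 ∈ Icc (0 : ℝ) 1 := by
  have h : ∀ᵐ x ∂unitMeasure, x ∈ Icc (0 : ℝ) 1 := ae_restrict_mem measurableSet_Icc
  filter_upwards [Measure.quasiMeasurePreserving_fst.ae h,
    Measure.quasiMeasurePreserving_snd.ae h] with q h1 h2 using ⟨h1, h2⟩

lemma coeFn_kernelOperator (W : Graphon) (f : Lp ℂ 2 unitMeasure) :
    W.kernelOperator f =ᵐ[unitMeasure] W.integralTransform f :=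
  MemLp.coeFn_toLp (W.memLp_integralTransform (Lp.memLp f))

/-- Fubini and the symmetry of the real kernel. It serves to make eigenspaces for distinct
eigenvalues orthogonal. -/
lemma isSymmetric_kernelOperator (W : Graphon) : W.kernelOperator.IsSymmetric := by
  intro f g
  have hf : Integrable f unitMeasure := (Lp.memLp f).integrable (by norm_num)
  have hg : Integrable g unitMeasure := (Lp.memLp g).integrable (by norm_num)
  have hF : Integrable (fun q : ℝ × ℝ =>
      (W.kernel q.1 q.2 : ℂ) * (g q.1 * (starRingEnd ℂ) (f q.2)))
      (unitMeasure.prod unitMeasure) := by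
    have hs : Integrable (fun y => (starRingEnd ℂ) (f y)) unitMeasure :=
      Complex.conjCLE.toContinuousLinearMap.integrable_comp hf
    refine (hg.mul_prod hs).bdd_mul (c := 1)
      W.measurable_ofReal_kernel.aestronglyMeasurable ?_
    filter_upwards [ae_mem_unit_prod] with q hq
    exact W.norm_kernel_le_one hq.1 hq.2
  rw [L2.inner_def, L2.inner_def]
  calc ∫ x, inner ℂ (W.kernelOperator f x) (g x) ∂unitMeasure
      = ∫ x, ∫ y, (W.kernel x y : ℂ) * (g x * (starRingEnd ℂ) (f y)) ∂unitMeasure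
          ∂unitMeasure := by
        refine integral_congr_ae ?_
        filter_upwards [W.coeFn_kernelOperator f] with x hx
        rw [hx, RCLike.inner_apply, integralTransform, ← integral_conj, ← integral_const_mul]
        refine integral_congr_ae (Filter.Eventually.of_forall fun y => ?_)
        simp only [map_mul, Complex.conj_ofReal]
        ring
    _ = ∫ y, ∫ x, (W.kernel x y : ℂ) * (g x * (starRingEnd ℂ) (f y)) ∂unitMeasure
          ∂unitMeasure := integral_integral_swap hF
    _ = ∫ y, inner ℂ (f y) (W.kernelOperator g y) ∂unitMeasure := by
        refine integral_congr_ae ?_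
        filter_upwards [W.coeFn_kernelOperator g, ae_restrict_mem measurableSet_Icc] with y hy hy'
        rw [hy, RCLike.inner_apply, integralTransform, ← integral_mul_const]
        refine integral_congr_ae ?_
        filter_upwards [ae_restrict_mem measurableSet_Icc] with x hx
        rw [W.symm x hx y hy']
        ring

lemma norm_sq_eq_integral (f : Lp ℂ 2 unitMeasure) :
    ‖f‖ ^ 2 = ∫ x, ‖f x‖ ^ 2 ∂unitMeasure := by
  have h : inner ℂ f f = ((∫ x, ‖f x‖ ^ 2 ∂unitMeasure : ℝ) : ℂ) := by
    rw [L2.inner_def, ← integral_complex_ofReal]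
    refine integral_congr_ae (Filter.Eventually.of_forall fun x => ?_)
    simp
  rw [norm_sq_eq_re_inner (𝕜 := ℂ) f, h]
  rfl

/-- Bessel's inequality for the sections of the kernel: the Hilbert–Schmidt norm of the kernel
operator of a graphon is at most one. -/
lemma sum_norm_sq_kernelOperator_le (W : Graphon) {ι : Type*} (s : Finset ι)
    {v : ι → Lp ℂ 2 unitMeasure} (hv : Orthonormal ℂ v) :
    ∑ i ∈ s, ‖W.kernelOperator (v i)‖ ^ 2 ≤ 1 := by
  have hint : ∀ f : Lp ℂ 2 unitMeasure, Integrable (fun x => ‖f x‖ ^ 2) unitMeasure := fun f =>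
    (memLp_two_iff_integrable_sq_norm (Lp.memLp f).1).1 (Lp.memLp f)
  simp_rw [norm_sq_eq_integral]
  rw [← integral_finsetSum _ fun i _ => hint _]
  have hall : ∀ᵐ x ∂unitMeasure, ∀ i ∈ s,
      W.kernelOperator (v i) x = W.integralTransform (v i) x :=
    (Filter.eventually_all_finset s).2 fun i _ => W.coeFn_kernelOperator (v i)
  calc ∫ x, ∑ i ∈ s, ‖W.kernelOperator (v i) x‖ ^ 2 ∂unitMeasure
      ≤ ∫ _, (1 : ℝ) ∂unitMeasure := by
        refine integral_mono_ae (integrable_finsetSum _ fun i _ => hint _)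
          (integrable_const _) ?_
        filter_upwards [hall, ae_restrict_mem measurableSet_Icc] with x hx hx'
        have hk : MemLp (fun y => (W.kernel x y : ℂ)) 2 unitMeasure := by
          refine MemLp.of_bound (W.measurable_ofReal_kernel.comp
            measurable_prodMk_left).aestronglyMeasurable 1 ?_
          filter_upwards [ae_restrict_mem measurableSet_Icc] with y hy
          exact W.norm_kernel_le_one hx' hy
        have hb := hv.sum_inner_products_le (hk.toLp _) (s := s)
        have hk1 : ‖hk.toLp _‖ ^ 2 ≤ 1 := by
          rw [norm_sq_eq_integral]
          calc _ ≤ ∫ _, (1 : ℝ) ∂unitMeasure := by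
                refine integral_mono_ae (hint _) (integrable_const _) ?_
                filter_upwards [hk.coeFn_toLp, ae_restrict_mem measurableSet_Icc] with y hy hy'
                rw [hy]
                exact pow_le_one₀ (norm_nonneg _) (W.norm_kernel_le_one hx' hy')
            _ = 1 := by simp
        refine (le_of_eq (Finset.sum_congr rfl fun i hi => ?_)).trans (hb.trans hk1)
        -- The section is real, so the value at `x` of the image of `v i` is the inner product of
        -- the section with `v i`.
        rw [hx i hi, ← inner_conj_symm, RCLike.norm_conj, L2.inner_def, integralTransform]
        congr 2
        refine integral_congr_ae ?_
        filter_upwards [hk.coeFn_toLp] with y hy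
        rw [hy, RCLike.inner_apply, Complex.conj_ofReal, mul_comm]
    _ = 1 := by simp

lemma norm_sq_kernelOperator_of_mem_eigenspace (W : Graphon) {μ : ℂ} {v : Lp ℂ 2 unitMeasure}
    (hv : v ∈ W.eigenspace μ) (h1 : ‖v‖ = 1) : ‖W.kernelOperator v‖ ^ 2 = ‖μ‖ ^ 2 := by
  rw [Module.End.mem_eigenspace_iff.1 hv, norm_smul, h1, mul_one]

/-- An infinite-dimensional eigenspace would contain `n` orthonormal eigenvectors for every `n`, and
the Hilbert–Schmidt bound would give `n * ‖μ‖ ^ 2 ≤ 1`. -/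
lemma finiteDimensional_eigenspace (W : Graphon) {μ : ℂ} (hμ : μ ≠ 0) :
    FiniteDimensional ℂ (W.eigenspace μ) := by
  by_contra hfin
  have hpos : 0 < ‖μ‖ ^ 2 := by positivity
  obtain ⟨n, hn⟩ := exists_nat_gt (1 / ‖μ‖ ^ 2)
  have hrank : (n : Cardinal) ≤ Module.rank ℂ (W.eigenspace μ) := by
    refine (Cardinal.natCast_lt_aleph0 (n := n)).le.trans ?_
    rw [← not_lt, Module.rank_lt_aleph0_iff]
    exact hfin
  obtain ⟨f, hf⟩ := exists_linearIndependent_of_le_rank hrank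
  have ho := InnerProductSpace.gramSchmidtNormed_orthonormal hf
  have hv := ho.comp_linearIsometry (W.eigenspace μ).subtypeₗᵢ
  have h := W.sum_norm_sq_kernelOperator_le Finset.univ hv
  have hnorm := fun i => W.norm_sq_kernelOperator_of_mem_eigenspace (Subtype.coe_prop _) (hv.1 i)
  replace h := (Finset.sum_congr rfl fun i _ => hnorm i).symm.trans_le h
  rw [Finset.sum_const, Finset.card_univ, Fintype.card_fin, nsmul_eq_mul] at h
  rw [div_lt_iff₀ hpos] at hn
  linarith

/-- Orthonormal bases of the mutually orthogonal eigenspaces together form one orthonormal family,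
to which the Hilbert–Schmidt bound applies. -/
lemma summable_eigenMult_mul_norm_sq (W : Graphon) :
    Summable fun μ : {μ : ℂ // μ ≠ 0} => (W.eigenMult μ : ℝ) * ‖(μ : ℂ)‖ ^ 2 := by
  refine summable_of_sum_le (c := 1) (fun μ => by positivity) fun u => ?_
  have := fun μ : {μ : ℂ // μ ≠ 0} => W.finiteDimensional_eigenspace μ.2
  have hO := (W.isSymmetric_kernelOperator.orthogonalFamily_eigenspaces).comp
    (γ := {μ : ℂ // μ ≠ 0}) Subtype.val_injective
  have ho := hO.orthonormal_sigma_orthonormal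
    (v_family := fun μ => stdOrthonormalBasis ℂ (W.eigenspace μ))
    fun μ => (stdOrthonormalBasis ℂ (W.eigenspace μ)).orthonormal
  have h := W.sum_norm_sq_kernelOperator_le (u.sigma fun _ => Finset.univ) ho
  rw [Finset.sum_sigma] at h
  refine (le_of_eq (Finset.sum_congr rfl fun μ _ => ?_)).trans h
  refine Eq.trans ?_ (Finset.sum_congr rfl fun i _ => W.norm_sq_kernelOperator_of_mem_eigenspace
    (Subtype.coe_prop _) (ho.1 ⟨μ, i⟩)).symm
  change _ = ∑ _ : Fin (W.eigenMult μ), ‖(μ : ℂ)‖ ^ 2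
  simp

end Graphon

/-! ### Convergence of the regularized product -/

lemma Complex.norm_one_sub_mul_exp_sub_one_le {w : ℂ} (hw : ‖w‖ ≤ 1) :
    ‖(1 - w) * Complex.exp w - 1‖ ≤ 3 * ‖w‖ ^ 2 := by
  have h1 := Complex.norm_exp_sub_one_sub_id_le hw
  have h2 : ‖1 - w‖ ≤ 2 := (norm_sub_le _ _).trans (by rw [norm_one]; linarith)
  calc ‖(1 - w) * Complex.exp w - 1‖
      -- The linear term cancels, which is why square-summable eigenvalues suffice.
      = ‖(1 - w) * (Complex.exp w - 1 - w) - w ^ 2‖ := by ring_nf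
    _ ≤ ‖1 - w‖ * ‖Complex.exp w - 1 - w‖ + ‖w‖ ^ 2 := by
        rw [← norm_mul, ← norm_pow]; exact norm_sub_le _ _
    _ ≤ 2 * ‖w‖ ^ 2 + ‖w‖ ^ 2 := by gcongr
    _ = 3 * ‖w‖ ^ 2 := by ring

lemma norm_pow_sub_one_le {a : ℂ} {m : ℕ} (h : m * ‖a - 1‖ ≤ 1) :
    ‖a ^ m - 1‖ ≤ 2 * (m * ‖a - 1‖) := by
  have h1 := Finset.norm_prod_one_add_sub_one_le (Finset.range m) (fun _ => a - 1)
  simp only [add_sub_cancel, Finset.prod_const, Finset.card_range, Finset.sum_const,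
    nsmul_eq_mul] at h1
  refine h1.trans ((le_abs_self _).trans ?_)
  have h0 : (0 : ℝ) ≤ m * ‖a - 1‖ := by positivity
  have h2 := Real.abs_exp_sub_one_le (x := m * ‖a - 1‖) (by rwa [abs_of_nonneg h0])
  rwa [abs_of_nonneg h0] at h2

namespace Graphon

lemma det2Converges (W : Graphon) (z : ℂ) : W.Det2Converges z := by
  refine ⟨fun μ hμ => W.finiteDimensional_eigenspace hμ, ?_⟩
  have hs := (W.summable_eigenMult_mul_norm_sq).mul_left (3 * ‖z‖ ^ 2)
  have hev : ∀ᶠ μ : {μ : ℂ // μ ≠ 0} in Filter.cofinite,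
      3 * ‖z‖ ^ 2 * (W.eigenMult μ * ‖(μ : ℂ)‖ ^ 2) ≤ 1 :=
    (hs.tendsto_cofinite_zero.eventually_lt_const one_pos).mono fun _ h => h.le
  have hsum : Summable fun μ => ‖W.detFactor z μ - 1‖ := by
    refine Summable.of_norm_bounded_eventually (hs.mul_left 2) (hev.mono fun μ h => ?_)
    rw [norm_norm, detFactor]
    -- With multiplicity `0` the factor is `1`, but `h` says nothing about `‖μ‖`. With multiplicity
    -- at least `1`, `h` forces `‖μ * z‖ ≤ 1`, as the estimate on `(1 - w) exp w` requires.
    rcases Nat.eq_zero_or_pos (W.eigenMult μ) with h0 | hpos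
    · simp [h0]
    have h1 : (1 : ℝ) ≤ W.eigenMult μ := by exact_mod_cast hpos
    have hw2 : 3 * ‖(μ : ℂ) * z‖ ^ 2 ≤ 1 := by
      rw [norm_mul]
      nlinarith [mul_nonneg (sub_nonneg.2 h1) (sq_nonneg (‖(μ : ℂ)‖ * ‖z‖))]
    have hw : ‖(μ : ℂ) * z‖ ≤ 1 := by nlinarith [norm_nonneg ((μ : ℂ) * z)]
    have h3 := Complex.norm_one_sub_mul_exp_sub_one_le hw
    have h4 : W.eigenMult μ * ‖(1 - (μ : ℂ) * z) * Complex.exp (μ * z) - 1‖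
        ≤ 3 * ‖z‖ ^ 2 * (W.eigenMult μ * ‖(μ : ℂ)‖ ^ 2) := by
      calc _ ≤ W.eigenMult μ * (3 * ‖(μ : ℂ) * z‖ ^ 2) := by gcongr
        _ = _ := by rw [norm_mul]; ring
    exact (norm_pow_sub_one_le (h4.trans h)).trans (by gcongr)
  simpa using multipliable_one_add_of_summable hsum

/-! ### Affine rescaling on the unit interval -/

/-- Dropping the endpoint `1` ensures `p * x < p`, since the point `p` itself belongs to the right
block. -/
lemma ae_mem_Ico : ∀ᵐ x ∂unitMeasure, x ∈ Ico (0 : ℝ) 1 := by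
  rw [unitMeasure, ← restrict_Ico_eq_restrict_Icc]
  exact ae_restrict_mem measurableSet_Ico

section Affine

variable {c : ℝ}

lemma map_affine_restrict (hc : 0 < c) (d a b : ℝ) :
    Measure.map (fun x => d + c * x) (volume.restrict (Icc a b)) =
      ENNReal.ofReal c⁻¹ • volume.restrict (Icc (d + c * a) (d + c * b)) := by
  have hm : Measurable (fun x : ℝ => d + c * x) := by fun_prop
  have hmap : Measure.map (fun x : ℝ => d + c * x) volume = ENNReal.ofReal c⁻¹ • volume := by
    have h1 := Real.map_volume_mul_left hc.ne'
    have h2 : Measure.map (fun x : ℝ => d + c * x) volume =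
        Measure.map (fun x => d + x) (Measure.map (fun x => c * x) volume) := by
      rw [Measure.map_map (by fun_prop) (by fun_prop)]
      rfl
    rw [h2, h1, Measure.map_smul, map_add_left_eq_self, abs_of_pos (inv_pos.2 hc)]
  have hpre : (fun x : ℝ => d + c * x) ⁻¹' Icc (d + c * a) (d + c * b) = Icc a b := by
    ext x
    simp [hc]
  rw [← Measure.restrict_smul, ← hmap, Measure.restrict_map hm measurableSet_Icc, hpre]

lemma memLp_comp_affine (hc : 0 < c) {d a b : ℝ} {f : ℝ → ℂ}
    (hf : MemLp f 2 (volume.restrict (Icc (d + c * a) (d + c * b)))) :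
    MemLp (fun x => f (d + c * x)) 2 (volume.restrict (Icc a b)) := by
  have h : MemLp f 2 (Measure.map (fun x => d + c * x) (volume.restrict (Icc a b))) := by
    rw [map_affine_restrict hc]
    exact hf.smul_measure ENNReal.ofReal_ne_top
  exact h.comp_of_map (by fun_prop)

variable {d : ℝ}

lemma quasiMeasurePreserving_affine (hc : 0 < c) (hd : 0 ≤ d) (hcd : d + c ≤ 1) :
    Measure.QuasiMeasurePreserving (fun x => d + c * x) unitMeasure unitMeasure := by
  refine ⟨by fun_prop, ?_⟩
  rw [map_affine_restrict hc]
  exact (Measure.smul_absolutelyContinuous).trans (Measure.restrict_mono_set _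
    (Icc_subset_Icc (by simpa using hd) (by simpa using hcd))).absolutelyContinuous

lemma memLp_affine (hc : 0 < c) (hd : 0 ≤ d) (hcd : d + c ≤ 1) {f : ℝ → ℂ}
    (hf : MemLp f 2 unitMeasure) : MemLp (fun x => f (d + c * x)) 2 unitMeasure :=
  memLp_comp_affine hc (hf.mono_measure (Measure.restrict_mono_set _
    (Icc_subset_Icc (by simpa using hd) (by simpa using hcd))))

/-- Precomposition with the affine map `x ↦ d + c x` of the unit interval into itself. -/
noncomputable def affineRestriction (hc : 0 < c) (hd : 0 ≤ d) (hcd : d + c ≤ 1) :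
    Lp ℂ 2 unitMeasure →ₗ[ℂ] Lp ℂ 2 unitMeasure where
  toFun f := (memLp_affine hc hd hcd (Lp.memLp f)).toLp _
  map_add' f g := by
    rw [← MemLp.toLp_add, MemLp.toLp_eq_toLp_iff]
    exact (quasiMeasurePreserving_affine hc hd hcd).ae (Lp.coeFn_add f g)
  map_smul' k f := by
    rw [RingHom.id_apply, ← MemLp.toLp_const_smul, MemLp.toLp_eq_toLp_iff]
    exact (quasiMeasurePreserving_affine hc hd hcd).ae (Lp.coeFn_smul k f)

lemma coeFn_affineRestriction (hc : 0 < c) (hd : 0 ≤ d) (hcd : d + c ≤ 1)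
    (f : Lp ℂ 2 unitMeasure) :
    affineRestriction hc hd hcd f =ᵐ[unitMeasure] fun x => f (d + c * x) :=
  MemLp.coeFn_toLp (memLp_affine hc hd hcd (Lp.memLp f))

end Affine

lemma integral_unitMeasure_eq {E : Type*} [NormedAddCommGroup E] [NormedSpace ℝ E] (f : ℝ → E) :
    ∫ x, f x ∂unitMeasure = ∫ x in (0 : ℝ)..1, f x := by
  rw [intervalIntegral.integral_of_le zero_le_one, ← integral_Icc_eq_integral_Ioc]

/-- Change of variables on `[0,p]` and `[p,1]`. The unsimplified `0 + p * x` matches the general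
form `d + c * x`. -/
lemma integral_split {E : Type*} [NormedAddCommGroup E] [NormedSpace ℝ E] {f : ℝ → E} {p : ℝ}
    (hp : p ∈ Icc (0 : ℝ) 1) (hf : Integrable f unitMeasure) :
    ∫ x, f x ∂unitMeasure = p • ∫ x, f (0 + p * x) ∂unitMeasure +
      (1 - p) • ∫ x, f (p + (1 - p) * x) ∂unitMeasure := by
  have hsub : ∀ a ∈ Icc (0 : ℝ) 1, ∀ b ∈ Icc (0 : ℝ) 1, a ≤ b →
      IntervalIntegrable f volume a b := fun a ha b hb hab =>
    (intervalIntegrable_iff_integrableOn_Icc_of_le hab).2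
      (IntegrableOn.mono_set hf (Icc_subset_Icc ha.1 hb.2))
  simp only [integral_unitMeasure_eq]
  rw [intervalIntegral.smul_integral_comp_add_mul, intervalIntegral.smul_integral_comp_add_mul]
  have h0 : (0 : ℝ) ∈ Icc (0 : ℝ) 1 := ⟨le_rfl, zero_le_one⟩
  have h1 : (1 : ℝ) ∈ Icc (0 : ℝ) 1 := ⟨zero_le_one, le_rfl⟩
  simp only [mul_zero, mul_one, add_zero, zero_add, add_sub_cancel]
  exact (intervalIntegral.integral_add_adjacent_intervals (hsub 0 h0 p hp hp.1)
    (hsub p hp 1 h1 hp.2)).symm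

/-! ### Splitting `L²([0,1])` and block-diagonalizing the operator -/

section Split

variable {p : ℝ}

/-- The pair of rescaled restrictions of `f ∈ L²([0,1])` to `[0,p]` and to `[p,1]`. -/
noncomputable def splitMap (h0 : 0 < p) (h1 : p < 1) :
    Lp ℂ 2 unitMeasure →ₗ[ℂ] Lp ℂ 2 unitMeasure × Lp ℂ 2 unitMeasure :=
  (affineRestriction h0 le_rfl (by rw [zero_add]; exact h1.le)).prod
    (affineRestriction (sub_pos.2 h1) h0.le (add_sub_cancel p 1).le)

lemma coeFn_splitMap_fst (h0 : 0 < p) (h1 : p < 1) (f : Lp ℂ 2 unitMeasure) :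
    (splitMap h0 h1 f).1 =ᵐ[unitMeasure] fun x => f (0 + p * x) :=
  coeFn_affineRestriction _ _ _ f

lemma coeFn_splitMap_snd (h0 : 0 < p) (h1 : p < 1) (f : Lp ℂ 2 unitMeasure) :
    (splitMap h0 h1 f).2 =ᵐ[unitMeasure] fun x => f (p + (1 - p) * x) :=
  coeFn_affineRestriction _ _ _ f

lemma ae_comp_left (h0 : 0 < p) (h1 : p < 1) {P : ℝ → Prop} (h : ∀ᵐ x ∂unitMeasure, P x) :
    ∀ᵐ x ∂unitMeasure, P (0 + p * x) :=
  (quasiMeasurePreserving_affine h0 le_rfl (by rw [zero_add]; exact h1.le)).ae h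

lemma ae_comp_right (h0 : 0 < p) (h1 : p < 1) {P : ℝ → Prop} (h : ∀ᵐ x ∂unitMeasure, P x) :
    ∀ᵐ x ∂unitMeasure, P (p + (1 - p) * x) :=
  (quasiMeasurePreserving_affine (sub_pos.2 h1) h0.le (add_sub_cancel p 1).le).ae h

/-- Both weights are positive, whence the injectivity of `splitMap`. -/
lemma norm_sq_split (h0 : 0 < p) (h1 : p < 1) (f : Lp ℂ 2 unitMeasure) :
    ‖f‖ ^ 2 = p * ‖(splitMap h0 h1 f).1‖ ^ 2 + (1 - p) * ‖(splitMap h0 h1 f).2‖ ^ 2 := by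
  rw [norm_sq_eq_integral, norm_sq_eq_integral, norm_sq_eq_integral,
    integral_split ⟨h0.le, h1.le⟩ ((memLp_two_iff_integrable_sq_norm (Lp.memLp f).1).1
      (Lp.memLp f)), smul_eq_mul, smul_eq_mul]
  congr 2
  · refine integral_congr_ae ?_
    filter_upwards [coeFn_splitMap_fst h0 h1 f] with x hx
    rw [hx]
  · refine integral_congr_ae ?_
    filter_upwards [coeFn_splitMap_snd h0 h1 f] with x hx
    rw [hx]

lemma injective_splitMap (h0 : 0 < p) (h1 : p < 1) : Function.Injective (splitMap h0 h1) := by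
  refine (injective_iff_map_eq_zero _).2 fun f hf => ?_
  have h := norm_sq_split h0 h1 f
  simpa [hf] using h

lemma surjective_splitMap (h0 : 0 < p) (h1 : p < 1) : Function.Surjective (splitMap h0 h1) := by
  classical
  rintro ⟨g, h⟩
  have h1' : 0 < 1 - p := sub_pos.2 h1
  -- The preimage glues `g (x / p)` and `h ((x - p) / (1 - p))`, with the arguments written as `d +
  -- c * x`.
  set F : ℝ → ℂ := (Iio p).piecewise (fun x => g (0 + p⁻¹ * x))
    (fun x => h (-p * (1 - p)⁻¹ + (1 - p)⁻¹ * x)) with hF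
  have hmem : MemLp F 2 unitMeasure := by
    refine MemLp.piecewise measurableSet_Iio ?_ ?_
    · have hg : MemLp (fun x => g (0 + p⁻¹ * x)) 2 (volume.restrict (Icc 0 p)) := by
        refine memLp_comp_affine (inv_pos.2 h0) ?_
        rw [inv_mul_cancel₀ h0.ne', mul_zero, zero_add, zero_add]
        exact Lp.memLp g
      refine hg.mono_measure ?_
      rw [Measure.restrict_restrict measurableSet_Iio]
      exact Measure.restrict_mono_set _ fun x hx => ⟨hx.2.1, hx.1.le⟩
    · have hh : MemLp (fun x => h (-p * (1 - p)⁻¹ + (1 - p)⁻¹ * x)) 2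
          (volume.restrict (Icc p 1)) := by
        refine memLp_comp_affine (inv_pos.2 h1') ?_
        have e1 : -p * (1 - p)⁻¹ + (1 - p)⁻¹ * p = 0 := by ring
        have e2 : -p * (1 - p)⁻¹ + (1 - p)⁻¹ * 1 = 1 := by field_simp; ring
        rw [e1, e2]
        exact Lp.memLp h
      refine hh.mono_measure ?_
      rw [Measure.restrict_restrict measurableSet_Iio.compl]
      exact Measure.restrict_mono_set _ fun x hx => ⟨not_lt.1 hx.1, hx.2.2⟩
  refine ⟨hmem.toLp F, Prod.ext (Lp.ext ?_) (Lp.ext ?_)⟩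
  · filter_upwards [coeFn_splitMap_fst h0 h1 (hmem.toLp F),
      ae_comp_left h0 h1 hmem.coeFn_toLp, ae_mem_Ico] with x hx hx' hx1
    have hlt : 0 + p * x ∈ Iio p := by
      rw [zero_add]; exact mul_lt_of_lt_one_right h0 hx1.2
    rw [hx, hx', hF, piecewise_eq_of_mem _ _ _ hlt]
    congr 1
    field_simp
    ring
  · filter_upwards [coeFn_splitMap_snd h0 h1 (hmem.toLp F),
      ae_comp_right h0 h1 hmem.coeFn_toLp, ae_mem_Ico] with x hx hx' hx1
    have hle : p + (1 - p) * x ∉ Iio p := by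
      have := mul_nonneg h1'.le hx1.1
      simp only [mem_Iio, not_lt]; linarith
    rw [hx, hx', hF, piecewise_eq_of_notMem _ _ _ hle]
    congr 1
    field_simp
    ring

/-- `L²([0,1])` as the product of the rescaled spaces `L²([0,p])` and `L²([p,1])`. -/
noncomputable def splitEquiv (h0 : 0 < p) (h1 : p < 1) :
    Lp ℂ 2 unitMeasure ≃ₗ[ℂ] Lp ℂ 2 unitMeasure × Lp ℂ 2 unitMeasure :=
  LinearEquiv.ofBijective (splitMap h0 h1) ⟨injective_splitMap h0 h1, surjective_splitMap h0 h1⟩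

lemma disjointUnionKernel_left_left (h0 : 0 < p) (G H : Graphon) {x y : ℝ}
    (hx : x < 1) (hy : y < 1) :
    disjointUnionKernel p G H (0 + p * x) (0 + p * y) = G.kernel x y := by
  rw [zero_add, zero_add, disjointUnionKernel,
    if_pos ⟨mul_lt_of_lt_one_right h0 hx, mul_lt_of_lt_one_right h0 hy⟩,
    mul_div_cancel_left₀ _ h0.ne', mul_div_cancel_left₀ _ h0.ne']

lemma disjointUnionKernel_left_right (h0 : 0 < p) (h1 : p < 1) (G H : Graphon) {x y : ℝ}
    (hx : x < 1) (hy : 0 ≤ y) :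
    disjointUnionKernel p G H (0 + p * x) (p + (1 - p) * y) = 0 := by
  have h2 : 0 + p * x < p := by rw [zero_add]; exact mul_lt_of_lt_one_right h0 hx
  have h3 : p ≤ p + (1 - p) * y := le_add_of_nonneg_right (mul_nonneg (sub_pos.2 h1).le hy)
  rw [disjointUnionKernel, if_neg fun h => h3.not_gt h.2, if_neg fun h => h2.not_ge h.1]

lemma disjointUnionKernel_right_left (h0 : 0 < p) (h1 : p < 1) (G H : Graphon) {x y : ℝ}
    (hx : 0 ≤ x) (hy : y < 1) :
    disjointUnionKernel p G H (p + (1 - p) * x) (0 + p * y) = 0 := by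
  have h2 : 0 + p * y < p := by rw [zero_add]; exact mul_lt_of_lt_one_right h0 hy
  have h3 : p ≤ p + (1 - p) * x := le_add_of_nonneg_right (mul_nonneg (sub_pos.2 h1).le hx)
  rw [disjointUnionKernel, if_neg fun h => h3.not_gt h.1, if_neg fun h => h2.not_ge h.2]

lemma disjointUnionKernel_right_right (h1 : p < 1) (G H : Graphon) {x y : ℝ}
    (hx : 0 ≤ x) (hy : 0 ≤ y) :
    disjointUnionKernel p G H (p + (1 - p) * x) (p + (1 - p) * y) = H.kernel x y := by
  have h2 : 0 < 1 - p := sub_pos.2 h1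
  have h3 : p ≤ p + (1 - p) * x := le_add_of_nonneg_right (mul_nonneg h2.le hx)
  have h4 : p ≤ p + (1 - p) * y := le_add_of_nonneg_right (mul_nonneg h2.le hy)
  rw [disjointUnionKernel, if_neg fun h => h3.not_gt h.1, if_pos ⟨h3, h4⟩,
    add_sub_cancel_left, add_sub_cancel_left, mul_div_cancel_left₀ _ h2.ne',
    mul_div_cancel_left₀ _ h2.ne']

lemma mem_unit_left {x : ℝ} (h0 : 0 < p) (h1 : p < 1) (hx : x ∈ Ico (0 : ℝ) 1) :
    0 + p * x ∈ Icc (0 : ℝ) 1 := by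
  rw [zero_add]
  exact ⟨mul_nonneg h0.le hx.1, mul_le_one₀ h1.le hx.1 hx.2.le⟩

lemma mem_unit_right {x : ℝ} (h0 : 0 < p) (h1 : p < 1) (hx : x ∈ Ico (0 : ℝ) 1) :
    p + (1 - p) * x ∈ Icc (0 : ℝ) 1 := by
  constructor <;> nlinarith [hx.1, hx.2]

/-- The off-diagonal blocks vanish; the factors `p` and `1 - p` are the Jacobians of the rescaled
inner integral. -/
lemma splitMap_kernelOperator (h0 : 0 < p) (h1 : p < 1) (hp : p ∈ Icc (0 : ℝ) 1)
    (G H : Graphon) (f : Lp ℂ 2 unitMeasure) :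
    splitMap h0 h1 ((disjointUnion p hp G H).kernelOperator f) =
      ((p : ℂ) • G.kernelOperator (splitMap h0 h1 f).1,
        (1 - p : ℂ) • H.kernelOperator (splitMap h0 h1 f).2) := by
  have hU := (disjointUnion p hp G H).coeFn_kernelOperator f
  have hint := fun x hx => (disjointUnion p hp G H).integrable_kernel_mul (Lp.memLp f) (x := x) hx
  refine Prod.ext (Lp.ext ?_) (Lp.ext ?_)
  · filter_upwards [coeFn_splitMap_fst h0 h1 ((disjointUnion p hp G H).kernelOperator f),
      ae_comp_left h0 h1 hU, ae_mem_Ico, G.coeFn_kernelOperator (splitMap h0 h1 f).1,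
      Lp.coeFn_smul (p : ℂ) (G.kernelOperator (splitMap h0 h1 f).1)] with x e1 e2 hx e3 e4
    rw [e1, e2, e4, Pi.smul_apply, e3, integralTransform, integralTransform,
      integral_split hp (hint _ (mem_unit_left h0 h1 hx))]
    have r1 : ∫ y, ((disjointUnion p hp G H).kernel (0 + p * x) (0 + p * y) : ℂ) *
        f (0 + p * y) ∂unitMeasure =
        ∫ y, (G.kernel x y : ℂ) * (splitMap h0 h1 f).1 y ∂unitMeasure := by
      refine integral_congr_ae ?_
      filter_upwards [ae_mem_Ico, coeFn_splitMap_fst h0 h1 f] with y hy e5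
      rw [e5]
      congr 2
      exact disjointUnionKernel_left_left h0 G H hx.2 hy.2
    have r2 : ∫ y, ((disjointUnion p hp G H).kernel (0 + p * x) (p + (1 - p) * y) : ℂ) *
        f (p + (1 - p) * y) ∂unitMeasure = 0 := by
      refine integral_eq_zero_of_ae ?_
      filter_upwards [ae_mem_Ico] with y hy
      have : (disjointUnion p hp G H).kernel (0 + p * x) (p + (1 - p) * y) = 0 :=
        disjointUnionKernel_left_right h0 h1 G H hx.2 hy.1
      rw [this, Complex.ofReal_zero, zero_mul, Pi.zero_apply]
    rw [r1, r2, smul_zero, add_zero, smul_eq_mul, Complex.real_smul]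
  · filter_upwards [coeFn_splitMap_snd h0 h1 ((disjointUnion p hp G H).kernelOperator f),
      ae_comp_right h0 h1 hU, ae_mem_Ico, H.coeFn_kernelOperator (splitMap h0 h1 f).2,
      Lp.coeFn_smul (1 - p : ℂ) (H.kernelOperator (splitMap h0 h1 f).2)] with x e1 e2 hx e3 e4
    rw [e1, e2, e4, Pi.smul_apply, e3, integralTransform, integralTransform,
      integral_split hp (hint _ (mem_unit_right h0 h1 hx))]
    have r1 : ∫ y, ((disjointUnion p hp G H).kernel (p + (1 - p) * x) (p + (1 - p) * y) : ℂ) *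
        f (p + (1 - p) * y) ∂unitMeasure =
        ∫ y, (H.kernel x y : ℂ) * (splitMap h0 h1 f).2 y ∂unitMeasure := by
      refine integral_congr_ae ?_
      filter_upwards [ae_mem_Ico, coeFn_splitMap_snd h0 h1 f] with y hy e5
      rw [e5]
      congr 2
      exact disjointUnionKernel_right_right h1 G H hx.1 hy.1
    have r2 : ∫ y, ((disjointUnion p hp G H).kernel (p + (1 - p) * x) (0 + p * y) : ℂ) *
        f (0 + p * y) ∂unitMeasure = 0 := by
      refine integral_eq_zero_of_ae ?_
      filter_upwards [ae_mem_Ico] with y hy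
      have : (disjointUnion p hp G H).kernel (p + (1 - p) * x) (0 + p * y) = 0 :=
        disjointUnionKernel_right_left h0 h1 G H hx.1 hy.2
      rw [this, Complex.ofReal_zero, zero_mul, Pi.zero_apply]
    rw [r1, r2, smul_zero, zero_add, smul_eq_mul, Complex.real_smul]
    push_cast
    rfl

end Split

end Graphon

/-! ### Multiplicities and determinant of the disjoint union -/

lemma Submodule.finrank_prod_eq_add {K V V' : Type*} [Field K] [AddCommGroup V] [Module K V]
    [AddCommGroup V'] [Module K V'] (S : Submodule K V) (T : Submodule K V')
    [FiniteDimensional K S] [FiniteDimensional K T] :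
    Module.finrank K (S.prod T) = Module.finrank K S + Module.finrank K T := by
  have h := LinearMap.range_prodMap S.subtype T.subtype
  rw [S.range_subtype, T.range_subtype] at h
  rw [← h, LinearMap.finrank_range_of_inj
    (Function.Injective.prodMap S.injective_subtype T.injective_subtype), Module.finrank_prod]

namespace Graphon

lemma mem_eigenspace_div_iff (W : Graphon) {c μ : ℂ} (hc : c ≠ 0) (f : Lp ℂ 2 unitMeasure) :
    f ∈ W.eigenspace (μ / c) ↔ c • W.kernelOperator f = μ • f := by
  rw [Module.End.mem_eigenspace_iff, ← (smul_right_injective _ hc).eq_iff (a := W.kernelOperator f),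
    smul_smul, mul_div_cancel₀ _ hc]

lemma eigenMult_disjointUnion {p : ℝ} (h0 : 0 < p) (h1 : p < 1) (hp : p ∈ Icc (0 : ℝ) 1)
    (G H : Graphon) {μ : ℂ} (hμ : μ ≠ 0) :
    (disjointUnion p hp G H).eigenMult μ =
      G.eigenMult (μ / (p : ℂ)) + H.eigenMult (μ / (1 - p : ℂ)) := by
  have hc : (p : ℂ) ≠ 0 := by exact_mod_cast h0.ne'
  have hc' : (1 - p : ℂ) ≠ 0 := by exact_mod_cast (sub_pos.2 h1).ne'
  have := G.finiteDimensional_eigenspace (div_ne_zero hμ hc)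
  have := H.finiteDimensional_eigenspace (div_ne_zero hμ hc')
  -- The eigenvalue equation can be tested after the injective `splitMap`, where it decouples into
  -- one equation per block.
  have hcomap : (disjointUnion p hp G H).eigenspace μ =
      ((G.eigenspace (μ / (p : ℂ))).prod (H.eigenspace (μ / (1 - p : ℂ)))).comap
        (splitEquiv h0 h1 : Lp ℂ 2 unitMeasure →ₗ[ℂ] _) := by
    ext f
    rw [Submodule.mem_comap, Submodule.mem_prod, mem_eigenspace_div_iff _ hc,
      mem_eigenspace_div_iff _ hc', Module.End.mem_eigenspace_iff,
      ← (injective_splitMap h0 h1).eq_iff, splitMap_kernelOperator h0 h1 hp, map_smul,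
      Prod.ext_iff]
    rfl
  rw [eigenMult, hcomap, ((splitEquiv h0 h1).ofSubmodule' _).finrank_eq,
    Submodule.finrank_prod_eq_add]
  rfl

/-- Division by a nonzero constant, as a permutation of the nonzero complex numbers. -/
noncomputable def divEquiv {c : ℂ} (hc : c ≠ 0) : {μ : ℂ // μ ≠ 0} ≃ {μ : ℂ // μ ≠ 0} where
  toFun μ := ⟨μ / c, div_ne_zero μ.2 hc⟩
  invFun μ := ⟨μ * c, mul_ne_zero μ.2 hc⟩
  left_inv _ := Subtype.ext (div_mul_cancel₀ _ hc)
  right_inv _ := Subtype.ext (mul_div_cancel_right₀ _ hc)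

lemma detFactor_divEquiv (W : Graphon) {c : ℂ} (hc : c ≠ 0) (z : ℂ) (μ : {μ : ℂ // μ ≠ 0}) :
    W.detFactor (c * z) (divEquiv hc μ) =
      ((1 - (μ : ℂ) * z) * Complex.exp ((μ : ℂ) * z)) ^ W.eigenMult (μ / c) := by
  have h : (divEquiv hc μ : ℂ) * (c * z) = μ * z := by
    change (μ : ℂ) / c * (c * z) = μ * z
    rw [← mul_assoc, div_mul_cancel₀ _ hc]
  rw [detFactor, h]
  rfl

/-- Since `(μ / c) * (c * z) = μ * z`, dividing the index by `p` or `1 - p` aligns the three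
products; unconditional convergence allows multiplying termwise. -/
lemma det2_disjointUnion {p : ℝ} (h0 : 0 < p) (h1 : p < 1) (hp : p ∈ Icc (0 : ℝ) 1)
    (G H : Graphon) (z : ℂ) :
    (disjointUnion p hp G H).det2 z = G.det2 (p * z) * H.det2 ((1 - p) * z) := by
  have hc : (p : ℂ) ≠ 0 := by exact_mod_cast h0.ne'
  have hc' : (1 - p : ℂ) ≠ 0 := by exact_mod_cast (sub_pos.2 h1).ne'
  have hfactor : ∀ μ, (disjointUnion p hp G H).detFactor z μ =
      (G.detFactor (p * z) ∘ divEquiv hc) μ * (H.detFactor ((1 - p) * z) ∘ divEquiv hc') μ := by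
    intro μ
    rw [Function.comp_apply, Function.comp_apply, detFactor_divEquiv, detFactor_divEquiv,
      ← pow_add, ← eigenMult_disjointUnion h0 h1 hp G H μ.2, detFactor]
  have hG := (divEquiv hc).multipliable_iff.2 (G.det2Converges (p * z)).2
  have hH := (divEquiv hc').multipliable_iff.2 (H.det2Converges ((1 - p) * z)).2
  rw [det2, tprod_congr hfactor, hG.tprod_mul hH]
  exact congrArg₂ (· * ·) ((divEquiv hc).tprod_eq _) ((divEquiv hc').tprod_eq _)

/-! ### Norms of the disjoint union -/

lemma integrable_comp_kernel (W : Graphon) {φ : ℝ → ℝ} (hφ : Continuous φ)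
    (hb : ∀ t ∈ Icc (0 : ℝ) 1, |φ t| ≤ 1) :
    Integrable (fun q : ℝ × ℝ => φ (W.kernel q.1 q.2)) (unitMeasure.prod unitMeasure) := by
  refine (integrable_const (1 : ℝ)).mono'
    (hφ.measurable.comp W.measurable_kernel).aestronglyMeasurable ?_
  filter_upwards [ae_mem_unit_prod] with q hq
  exact hb _ (W.mem_Icc _ hq.1 _ hq.2)

lemma integrable_comp_kernel_section (W : Graphon) {φ : ℝ → ℝ} (hφ : Continuous φ)
    (hb : ∀ t ∈ Icc (0 : ℝ) 1, |φ t| ≤ 1) {x : ℝ} (hx : x ∈ Icc (0 : ℝ) 1) :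
    Integrable (fun y => φ (W.kernel x y)) unitMeasure := by
  refine (integrable_const (1 : ℝ)).mono'
    (hφ.measurable.comp (W.measurable_kernel.comp measurable_prodMk_left)).aestronglyMeasurable ?_
  filter_upwards [ae_restrict_mem measurableSet_Icc] with y hy
  exact hb _ (W.mem_Icc _ hx _ hy)

/-- Handles both norms at once, with `φ` equal to `|t|` or `|t| ^ 2`. Splitting each variable
contributes one Jacobian, hence the squares; `φ 0 = 0` removes the off-diagonal blocks. -/
lemma integral_comp_disjointUnion {p : ℝ} (h0 : 0 < p) (h1 : p < 1) (hp : p ∈ Icc (0 : ℝ) 1)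
    (G H : Graphon) {φ : ℝ → ℝ} (hφ : Continuous φ) (hφ0 : φ 0 = 0)
    (hb : ∀ t ∈ Icc (0 : ℝ) 1, |φ t| ≤ 1) :
    ∫ q : ℝ × ℝ, φ ((disjointUnion p hp G H).kernel q.1 q.2) ∂(unitMeasure.prod unitMeasure) =
      p ^ 2 * ∫ q : ℝ × ℝ, φ (G.kernel q.1 q.2) ∂(unitMeasure.prod unitMeasure) +
      (1 - p) ^ 2 * ∫ q : ℝ × ℝ, φ (H.kernel q.1 q.2) ∂(unitMeasure.prod unitMeasure) := by
  set U := disjointUnion p hp G H with hU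
  have hUi := U.integrable_comp_kernel hφ hb
  rw [integral_prod _ hUi, integral_prod _ (G.integrable_comp_kernel hφ hb),
    integral_prod _ (H.integrable_comp_kernel hφ hb), integral_split hp hUi.integral_prod_left]
  have hsplit := fun x hx => integral_split hp (U.integrable_comp_kernel_section hφ hb (x := x) hx)
  have e1 : ∫ x, ∫ y, φ (U.kernel (0 + p * x) y) ∂unitMeasure ∂unitMeasure =
      p * ∫ x, ∫ y, φ (G.kernel x y) ∂unitMeasure ∂unitMeasure := by
    rw [← integral_const_mul]
    refine integral_congr_ae ?_
    filter_upwards [ae_mem_Ico] with x hx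
    rw [hsplit _ (mem_unit_left h0 h1 hx)]
    have r1 : ∫ y, φ (U.kernel (0 + p * x) (0 + p * y)) ∂unitMeasure =
        ∫ y, φ (G.kernel x y) ∂unitMeasure := by
      refine integral_congr_ae ?_
      filter_upwards [ae_mem_Ico] with y hy
      exact congrArg φ (disjointUnionKernel_left_left h0 G H hx.2 hy.2)
    have r2 : ∫ y, φ (U.kernel (0 + p * x) (p + (1 - p) * y)) ∂unitMeasure = 0 := by
      refine integral_eq_zero_of_ae ?_
      filter_upwards [ae_mem_Ico] with y hy
      exact (congrArg φ (disjointUnionKernel_left_right h0 h1 G H hx.2 hy.1)).trans hφ0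
    rw [r1, r2, smul_zero, add_zero, smul_eq_mul]
  have e2 : ∫ x, ∫ y, φ (U.kernel (p + (1 - p) * x) y) ∂unitMeasure ∂unitMeasure =
      (1 - p) * ∫ x, ∫ y, φ (H.kernel x y) ∂unitMeasure ∂unitMeasure := by
    rw [← integral_const_mul]
    refine integral_congr_ae ?_
    filter_upwards [ae_mem_Ico] with x hx
    rw [hsplit _ (mem_unit_right h0 h1 hx)]
    have r1 : ∫ y, φ (U.kernel (p + (1 - p) * x) (p + (1 - p) * y)) ∂unitMeasure =
        ∫ y, φ (H.kernel x y) ∂unitMeasure := by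
      refine integral_congr_ae ?_
      filter_upwards [ae_mem_Ico] with y hy
      exact congrArg φ (disjointUnionKernel_right_right h1 G H hx.1 hy.1)
    have r2 : ∫ y, φ (U.kernel (p + (1 - p) * x) (0 + p * y)) ∂unitMeasure = 0 := by
      refine integral_eq_zero_of_ae ?_
      filter_upwards [ae_mem_Ico] with y hy
      exact (congrArg φ (disjointUnionKernel_right_left h0 h1 G H hx.1 hy.2)).trans hφ0
    rw [r1, r2, smul_zero, zero_add, smul_eq_mul]
  rw [e1, e2, smul_eq_mul, smul_eq_mul]
  ring

lemma normOne_disjointUnion {p : ℝ} (h0 : 0 < p) (h1 : p < 1) (hp : p ∈ Icc (0 : ℝ) 1)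
    (G H : Graphon) :
    (disjointUnion p hp G H).normOne = p ^ 2 * G.normOne + (1 - p) ^ 2 * H.normOne :=
  integral_comp_disjointUnion h0 h1 hp G H (φ := fun t => |t|) continuous_abs abs_zero
    fun t ht => by rw [abs_abs, abs_of_nonneg ht.1]; exact ht.2

lemma normTwoSq_disjointUnion {p : ℝ} (h0 : 0 < p) (h1 : p < 1) (hp : p ∈ Icc (0 : ℝ) 1)
    (G H : Graphon) :
    (disjointUnion p hp G H).normTwoSq = p ^ 2 * G.normTwoSq + (1 - p) ^ 2 * H.normTwoSq :=
  integral_comp_disjointUnion h0 h1 hp G H (φ := fun t => |t| ^ 2) (by fun_prop) (by simp)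
    fun t ht => by
      rw [abs_of_nonneg (sq_nonneg _), abs_of_nonneg ht.1]
      exact pow_le_one₀ ht.1 ht.2

/-! ### Assembly and the degenerate cases -/

lemma charPowerSeries_disjointUnion {p : ℝ} (h0 : 0 < p) (h1 : p < 1) (hp : p ∈ Icc (0 : ℝ) 1)
    (G H : Graphon) (z : ℂ) :
    (disjointUnion p hp G H).charPowerSeries z =
      G.charPowerSeries (p * z) * H.charPowerSeries ((1 - p) * z) := by
  rw [charPowerSeries, charPowerSeries, charPowerSeries, det2_disjointUnion h0 h1,
    normOne_disjointUnion h0 h1, normTwoSq_disjointUnion h0 h1, mul_mul_mul_comm, ← Complex.exp_add]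
  congr 2
  push_cast
  ring

lemma charPowerSeries_zero (W : Graphon) : W.charPowerSeries 0 = 1 := by
  simp [charPowerSeries, det2, detFactor]

/-- The characteristic power series does not see the values of the kernel on the part of the
boundary of the unit square where a coordinate is `1`. -/
lemma charPowerSeries_congr {V W : Graphon}
    (h : ∀ x ∈ Ico (0 : ℝ) 1, ∀ y ∈ Ico (0 : ℝ) 1, V.kernel x y = W.kernel x y) (z : ℂ) :
    V.charPowerSeries z = W.charPowerSeries z := by
  have hop : V.kernelOperator = W.kernelOperator := by
    ext1 f
    refine Lp.ext ?_
    filter_upwards [V.coeFn_kernelOperator f, W.coeFn_kernelOperator f, ae_mem_Ico]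
      with x hV hW hx
    rw [hV, hW]
    refine integral_congr_ae ?_
    filter_upwards [ae_mem_Ico] with y hy
    rw [h x hx y hy]
  have hae : ∀ᵐ q : ℝ × ℝ ∂(unitMeasure.prod unitMeasure),
      V.kernel q.1 q.2 = W.kernel q.1 q.2 := by
    filter_upwards [Measure.quasiMeasurePreserving_fst.ae ae_mem_Ico,
      Measure.quasiMeasurePreserving_snd.ae ae_mem_Ico] with q h1 h2 using h _ h1 _ h2
  have hone : V.normOne = W.normOne :=
    integral_congr_ae (hae.mono fun q hq => congrArg (fun t => |t|) hq)
  have htwo : V.normTwoSq = W.normTwoSq :=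
    integral_congr_ae (hae.mono fun q hq => congrArg (fun t => |t| ^ 2) hq)
  have hdet : V.det2 z = W.det2 z := by
    refine tprod_congr fun μ => ?_
    rw [detFactor, detFactor, eigenMult, eigenMult, eigenspace, eigenspace, hop]
  rw [charPowerSeries, charPowerSeries, hdet, hone, htwo]

lemma charPowerSeries_disjointUnion_zero (hp : (0 : ℝ) ∈ Icc (0 : ℝ) 1) (G H : Graphon) (z : ℂ) :
    (disjointUnion 0 hp G H).charPowerSeries z = H.charPowerSeries z := by
  refine charPowerSeries_congr (fun x hx y hy => ?_) z
  change disjointUnionKernel 0 G H x y = _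
  rw [disjointUnionKernel, if_neg fun h => hx.1.not_gt h.1, if_pos ⟨hx.1, hy.1⟩]
  simp

lemma charPowerSeries_disjointUnion_one (hp : (1 : ℝ) ∈ Icc (0 : ℝ) 1) (G H : Graphon) (z : ℂ) :
    (disjointUnion 1 hp G H).charPowerSeries z = G.charPowerSeries z := by
  refine charPowerSeries_congr (fun x hx y hy => ?_) z
  change disjointUnionKernel 1 G H x y = _
  -- For `p = 1` the left block is `[0,1) × [0,1)`, so only the null set where a coordinate is `1`
  -- differs from `G`.
  rw [disjointUnionKernel, if_pos ⟨hx.2, hy.2⟩, div_one, div_one]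

end Graphon

theorem corollary1 (G H : Graphon) (p : ℝ) (hp : p ∈ Set.Icc (0 : ℝ) 1) (z : ℂ) :
    G.Det2Converges ((p : ℂ) * z) ∧
    H.Det2Converges ((1 - (p : ℂ)) * z) ∧
    (Graphon.disjointUnion p hp G H).Det2Converges z ∧
    (Graphon.disjointUnion p hp G H).charPowerSeries z =
      G.charPowerSeries ((p : ℂ) * z) * H.charPowerSeries ((1 - (p : ℂ)) * z) := by
  refine ⟨G.det2Converges _, H.det2Converges _, Graphon.det2Converges _ _, ?_⟩
  -- At the endpoints one of the affine maps is constant and `splitMap` is unavailable.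
  rcases hp.1.eq_or_lt with rfl | h0
  · rw [Graphon.charPowerSeries_disjointUnion_zero]
    simp [Graphon.charPowerSeries_zero]
  rcases hp.2.eq_or_lt with rfl | h1
  · rw [Graphon.charPowerSeries_disjointUnion_one]
    simp [Graphon.charPowerSeries_zero]
  exact Graphon.charPowerSeries_disjointUnion h0 h1 hp G H z
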